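/- Let $n\ge 0$ be an integer and let $$\mathrm{Sp}(2n)=\{\Psi\in\mathbb{R}^{2n\times 2n} : \Psi J_0\Psi^{T}=J_0\},\qquad J_0=\begin{pmatrix}0&-\mathbb{1}\\ \mathbb{1}&0\end{pmatrix},$$ be the group of real symplectic matrices. Let $\widetilde{\mathrm{Sp}}(2n)$ be its universal cover, that is, the group of homotopy classes $[\Psi]$ (with fixed endpoints) of continuous paths $\Psi:[0,1]\to\mathrm{Sp}(2n)$ with $\Psi(0)=\mathbb{1}$, with the product induced by pointwise multiplication of paths. A homogeneous quasimorphism on a group $G$ is a map $\rho:G\to\mathbb{R}$ such that, for some constant $C$, $|\rho(gh)-\rho(g)-\rho(h)|\le C$ for all $g,h\in G$, and such that $\rho(g^k)=k\rho(g)$ for every $g\in G$ and every integer $k\ge 0$. **Theorem 1.** There is exactly one homogeneous quasimorphism $\mu$ on $\widetilde{\mathrm{Sp}}(2n)$ that descends to the determinant homomorphism on $\mathrm{U}(n)\cong\mathrm{Sp}(2n)\cap\mathrm{O}(2n)$, in the sense that $$\det(X+iY)=\exp\bigl(2\pi i\,\mu([\Psi])\bigr),\qquad \begin{pmatrix}X&-Y\\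 Y&X\end{pmatrix}:=\Psi(1),$$ for every $[\Psi]\in\widetilde{\mathrm{Sp}}(2n)$ with $\Psi(1)\in\mathrm{Sp}(2n)\cap\mathrm{O}(2n)$. -/

import Mathlib

/-! ### Homogeneous quasimorphisms -/

/-- A quasimorphism on a group: a real-valued map whose defect is bounded by a constant. -/
def IsQuasimorphism {G : Type*} [Group G] (ρ : G → ℝ) : Prop :=
  ∃ C : ℝ, ∀ g h : G, |ρ (g * h) - ρ g - ρ h| ≤ C

/-- A homogeneous quasimorphism: a quasimorphism `ρ` with `ρ (g ^ k) = k ρ(g)` for every `g` and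
every integer `k ≥ 0`. -/
def IsHomogeneousQuasimorphism {G : Type*} [Group G] (ρ : G → ℝ) : Prop :=
  IsQuasimorphism ρ ∧ ∀ (g : G) (k : ℕ), ρ (g ^ k) = k * ρ g

/-! ### The universal cover of a topological group, as a group of homotopy classes of paths -/

section UniversalCover

variable (G : Type*) [Group G] [TopologicalSpace G] [IsTopologicalGroup G]

/-- The group, under pointwise multiplication, of continuous paths `γ : [0, 1] → G` that start at
the identity. -/
def basedPaths : Subgroup C(unitInterval, G) where
  carrier := {γ | γ 0 = 1}
  mul_mem' {γ δ} hγ hδ := by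
    have h₁ : γ 0 = 1 := hγ
    have h₂ : δ 0 = 1 := hδ
    change γ 0 * δ 0 = 1
    rw [h₁, h₂, mul_one]
  one_mem' := rfl
  inv_mem' {γ} hγ := by
    have h₁ : γ 0 = 1 := hγ
    change (γ 0)⁻¹ = 1
    rw [h₁, inv_one]

/-- Homotopy with fixed endpoints, on paths that start at the identity. It is compatible with
pointwise multiplication. -/
def pathHomotopyCon : Con (basedPaths G) where
  r γ δ := ContinuousMap.HomotopicRel (γ : C(unitInterval, G)) (δ : C(unitInterval, G)) {0, 1}
  iseqv := ⟨fun γ => ContinuousMap.HomotopicRel.refl γ.1, fun h => h.symm,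
    fun h₁ h₂ => h₁.trans h₂⟩
  mul' := by
    rintro γ γ' δ δ' ⟨F⟩ ⟨H⟩
    refine ⟨⟨⟨F.toContinuousMap * H.toContinuousMap, fun t => ?_, fun t => ?_⟩, fun s t ht => ?_⟩⟩
    · change F (0, t) * H (0, t) = γ.1 t * δ.1 t
      rw [F.apply_zero, H.apply_zero]
    · change F (1, t) * H (1, t) = γ'.1 t * δ'.1 t
      rw [F.apply_one, H.apply_one]
    · change F (s, t) * H (s, t) = γ.1 t * δ.1 t
      rw [F.eq_fst s ht, H.eq_fst s ht]

/-- The universal cover of a connected Lie group `G`, as a group: homotopy classes, with fixed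
endpoints, of paths in `G` that start at the identity, multiplied pointwise. -/
abbrev UniversalCover : Type _ := (pathHomotopyCon G).Quotient

/-- The covering homomorphism `[γ] ↦ γ(1)`. -/
def UniversalCover.endpoint : UniversalCover G →* G :=
  (pathHomotopyCon G).lift
    { toFun := fun γ => (γ : C(unitInterval, G)) 1
      map_one' := rfl
      map_mul' := fun _ _ => rfl }
    (fun _ _ h => h.fst_eq_snd (by simp))

end UniversalCover

/-! ### The symplectic group `Sp(2n)` and its universal cover -/

/-- `Sp(2n)` is the group of real matrices `Ψ` with `Ψ J₀ Ψᵀ = J₀`, where `J₀` is the block matrix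
with rows `(0, -1)` and `(1, 0)`; its topology is that of the space of matrices. -/
abbrev Sp (n : ℕ) : Type := Matrix.symplecticGroup (Fin n) ℝ

instance Sp.instIsTopologicalGroup (n : ℕ) : IsTopologicalGroup (Sp n) where
  continuous_inv := by
    refine Continuous.subtype_mk
      (f := fun A : Sp n => (-Matrix.J (Fin n) ℝ) * A.1.transpose * Matrix.J (Fin n) ℝ) ?_ _
    fun_prop

/-- `μ` descends to the determinant on `U(n) ≅ Sp(2n) ∩ O(2n)`: whenever the endpoint of a class
`g` is orthogonal, and so has the block form with rows `(X, -Y)` and `(Y, X)`, one has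
`det (X + iY) = exp (2πi μ(g))`. -/
def DescendsToDet {n : ℕ} (μ : UniversalCover (Sp n) → ℝ) : Prop :=
  ∀ (g : UniversalCover (Sp n)) (X Y : Matrix (Fin n) (Fin n) ℝ),
    (UniversalCover.endpoint (Sp n) g : Matrix (Fin n ⊕ Fin n) (Fin n ⊕ Fin n) ℝ) ∈
      Matrix.orthogonalGroup (Fin n ⊕ Fin n) ℝ →
    (UniversalCover.endpoint (Sp n) g : Matrix (Fin n ⊕ Fin n) (Fin n ⊕ Fin n) ℝ) =
      Matrix.fromBlocks X (-Y) Y X →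
    (X.map Complex.ofReal + Complex.I • Y.map Complex.ofReal).det =
      Complex.exp (2 * Real.pi * Complex.I * μ g)

/-! ### Algebra of homogeneous quasimorphisms -/

namespace IsHomogeneousQuasimorphism

variable {G : Type*} [Group G] {ρ σ : G → ℝ}

/-! Uniqueness: the difference `ρ` of two solutions is a homogeneous quasimorphism with integral
values over `U(n)`. A path `exp(itL)` has roots of every order of the same form, so integrality
forces `ρ` to vanish on it; since the exponential has continuous local sections and `ρ` is additive
on the central classes of loops, `ρ` vanishes on every path in `U(n)` (`mk_unitaryToSp_eq_zero`). By
polar decomposition any path in `Sp(2n)` is a unitary path times a path `P` of positive symplectic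
matrices. As `J P J⁻¹ = P⁻¹` and `J` lies on a path from the identity, `[P]` is conjugate to its
inverse, so `ρ` is zero there. Hence `|ρ|` is bounded by its defect, and a bounded homogeneous
quasimorphism is zero.

Existence: write a symplectic matrix as `z ↦ a z + b z̄` on `ℂⁿ`. Then `a` is invertible, and the
winding of `det a` along a path defines `ρ` on the universal cover. For a product, the linear part
is `a (1 + K) a'` with `‖K‖ < 1`, so the defect of `ρ` is the change of argument of `det (1 + sK)`
for `s ∈ [0, 1]`, at most half a turn per eigenvalue. Homogenizing `ρ` does not change it over
`U(n)`, where `K = 0` makes it additive on powers. -/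

theorem eq_zero_of_forall_nat_mul_abs_le {x C : ℝ} (h : ∀ k : ℕ, k * |x| ≤ C) : x = 0 := by
  by_contra hx
  obtain ⟨k, hk⟩ := exists_nat_gt (C / |x|)
  have h₁ := (div_lt_iff₀ (abs_pos.mpr hx)).mp hk
  linarith [h k]

theorem sub (hρ : IsHomogeneousQuasimorphism ρ) (hσ : IsHomogeneousQuasimorphism σ) :
    IsHomogeneousQuasimorphism (fun g => ρ g - σ g) := by
  obtain ⟨⟨C, hC⟩, h₁⟩ := hρ
  obtain ⟨⟨D, hD⟩, h₂⟩ := hσ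
  refine ⟨⟨C + D, fun g h => ?_⟩, fun g k => ?_⟩
  · have h₃ := abs_le.mp (hC g h)
    have h₄ := abs_le.mp (hD g h)
    rw [abs_le]
    constructor <;> linarith [h₃.1, h₃.2, h₄.1, h₄.2]
  · simp only [h₁, h₂, mul_sub]

/-- The defect at `(g ^ k, h ^ k)` is `k` times the defect at `(g, h)`, yet stays bounded by `C`. -/
theorem map_mul_of_commute (hρ : IsHomogeneousQuasimorphism ρ) {g h : G} (hgh : Commute g h) :
    ρ (g * h) = ρ g + ρ h := by
  obtain ⟨⟨C, hC⟩, hk⟩ := hρ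
  have : ρ (g * h) - ρ g - ρ h = 0 := by
    refine eq_zero_of_forall_nat_mul_abs_le (C := C) fun k => ?_
    have h₁ := hC (g ^ k) (h ^ k)
    rw [← hgh.mul_pow, hk, hk, hk, ← mul_sub, ← mul_sub, abs_mul, Nat.abs_cast] at h₁
    exact h₁
  linarith

theorem map_one (hρ : IsHomogeneousQuasimorphism ρ) : ρ 1 = 0 := by
  have := hρ.map_mul_of_commute (Commute.refl (1 : G))
  rw [mul_one] at this
  linarith

theorem map_inv (hρ : IsHomogeneousQuasimorphism ρ) (g : G) : ρ g⁻¹ = -ρ g := by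
  have := hρ.map_mul_of_commute (Commute.refl g).inv_right
  rw [mul_inv_cancel, hρ.map_one] at this
  linarith

theorem map_conj (hρ : IsHomogeneousQuasimorphism ρ) (g h : G) : ρ (h * g * h⁻¹) = ρ g := by
  obtain ⟨C, hC⟩ := hρ.1
  have : ρ (h * g * h⁻¹) - ρ g = 0 := by
    refine eq_zero_of_forall_nat_mul_abs_le (C := 2 * C) fun k => ?_
    have h₁ := abs_le.mp (hC (h * g ^ k) h⁻¹)
    have h₂ := abs_le.mp (hC h (g ^ k))
    rw [← conj_pow, hρ.2, hρ.map_inv] at h₁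
    rw [hρ.2] at h₂
    rw [← Nat.abs_cast (R := ℝ), ← abs_mul, abs_le]
    constructor <;> linarith [h₁.1, h₁.2, h₂.1, h₂.2]
  linarith

/-- A bounded homogeneous quasimorphism vanishes. -/
theorem eq_zero_of_bounded (hρ : IsHomogeneousQuasimorphism ρ) {C : ℝ} (hC : ∀ g, |ρ g| ≤ C)
    (g : G) : ρ g = 0 := by
  refine eq_zero_of_forall_nat_mul_abs_le (C := C) fun k => ?_
  rw [← Nat.abs_cast (R := ℝ), ← abs_mul, ← hρ.2]
  exact hC _

/-- An integral value at an element all of whose roots exist and have integral values vanishes. -/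
theorem eq_zero_of_divisible (hρ : IsHomogeneousQuasimorphism ρ) {g : G}
    (h : ∀ k : ℕ, ∃ (a : G) (m : ℤ), a ^ (k + 1) = g ∧ ρ a = m) : ρ g = 0 := by
  obtain ⟨k, hk⟩ := exists_nat_gt |ρ g|
  obtain ⟨a, m, rfl, hm⟩ := h k
  rw [hρ.2, hm] at hk ⊢
  rcases eq_or_ne m 0 with rfl | hm0
  · simp
  · exfalso
    -- If `m ≠ 0`, then `|ρ g| = (k + 1)|m| ≥ k + 1`, against the choice of `k`.
    have h₁ : (1 : ℝ) ≤ |(m : ℝ)| := by exact_mod_cast Int.one_le_abs hm0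
    rw [abs_mul, Nat.abs_cast] at hk
    push_cast at hk
    nlinarith

end IsHomogeneousQuasimorphism

open Filter Topology in
/-- The homogenization of a quasimorphism. -/
theorem IsQuasimorphism.exists_homogenization {G : Type*} [Group G] {ρ : G → ℝ}
    (hρ : IsQuasimorphism ρ) :
    ∃ μ : G → ℝ, IsHomogeneousQuasimorphism μ ∧
      ∀ g, (∀ k : ℕ, ρ (g ^ k) = k * ρ g) → μ g = ρ g := by
  obtain ⟨C, hC⟩ := hρ
  have hC0 : 0 ≤ C := (abs_nonneg _).trans (hC 1 1)
  have hbound : ∀ (g : G) (k : ℕ), |ρ (g ^ k) - k * ρ g| ≤ C * (k + 1) := by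
    intro g k
    induction k with
    | zero =>
      have := hC 1 1
      simp only [mul_one, sub_self, zero_sub, abs_neg] at this
      simpa using this
    | succ k ih =>
      have h₁ := abs_le.mp (hC (g ^ k) g)
      have h₂ := abs_le.mp ih
      rw [pow_succ, abs_le]
      push_cast
      constructor <;> linarith [h₁.1, h₁.2, h₂.1, h₂.2]
  -- Adding the defect bound makes the sequence subadditive, so Fekete's lemma gives the limit of `ρ
  -- (g ^ k) / k`.
  have hsub : ∀ g : G, Subadditive fun k : ℕ => ρ (g ^ k) + C := by
    intro g m k
    have h₁ := abs_le.mp (hC (g ^ m) (g ^ k))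
    rw [← pow_add] at h₁
    linarith [h₁.2]
  have hbdd : ∀ g : G, BddBelow (Set.range fun k : ℕ => (ρ (g ^ k) + C) / k) := by
    intro g
    refine ⟨-(|ρ g| + 2 * C), ?_⟩
    rintro _ ⟨k, rfl⟩
    rcases Nat.eq_zero_or_pos k with rfl | hk
    · simp only [Nat.cast_zero, div_zero]
      linarith [abs_nonneg (ρ g)]
    · have hk' : (1 : ℝ) ≤ k := by exact_mod_cast hk
      have h₁ := abs_le.mp (hbound g k)
      change _ ≤ (ρ (g ^ k) + C) / k
      rw [le_div_iff₀ (by linarith)]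
      nlinarith [neg_abs_le (ρ g), h₁.1]
  have hlim : ∀ g : G, Tendsto (fun k : ℕ => ρ (g ^ k) / k) atTop (𝓝 (hsub g).lim) := by
    intro g
    have h₁ := (hsub g).tendsto_lim (hbdd g)
    have h₂ := h₁.sub (tendsto_const_div_atTop_nhds_zero_nat C)
    simpa only [add_div, add_sub_cancel_right, sub_zero] using h₂
  have hclose : ∀ g : G, |(hsub g).lim - ρ g| ≤ C := by
    intro g
    have h₁ : Tendsto (fun k : ℕ => C * (k + 1) / k) atTop (𝓝 C) := by
      have := (tendsto_const_div_atTop_nhds_zero_nat C).const_add C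
      rw [add_zero] at this
      refine this.congr' ?_
      filter_upwards [eventually_gt_atTop 0] with k hk
      have : (k : ℝ) ≠ 0 := by positivity
      field_simp
    refine le_of_tendsto_of_tendsto ((hlim g).sub_const (ρ g)).abs h₁ ?_
    filter_upwards [eventually_gt_atTop 0] with k hk
    have hk' : (0 : ℝ) < k := by exact_mod_cast hk
    rw [le_div_iff₀ hk', ← abs_of_pos hk', ← abs_mul, abs_of_pos hk', sub_mul,
      div_mul_cancel₀ _ hk'.ne', mul_comm (ρ g)]
    exact hbound g k
  -- In `4 * C`, one `C` is the defect of `ρ` and three come from replacing `ρ` by the limit at `g *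
  -- h`, `g` and `h`.
  refine ⟨fun g => (hsub g).lim, ⟨⟨4 * C, fun g h => ?_⟩, fun g k => ?_⟩, fun g hg => ?_⟩
  · have h₁ := abs_le.mp (hclose (g * h))
    have h₂ := abs_le.mp (hclose g)
    have h₃ := abs_le.mp (hclose h)
    have h₄ := abs_le.mp (hC g h)
    rw [abs_le]
    constructor <;> linarith [h₁.1, h₁.2, h₂.1, h₂.2, h₃.1, h₃.2, h₄.1, h₄.2]
  · rcases Nat.eq_zero_or_pos k with rfl | hk
    · simp only [pow_zero, Nat.cast_zero, zero_mul]
      refine tendsto_nhds_unique (hlim 1) ?_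
      simpa only [one_pow] using tendsto_const_div_atTop_nhds_zero_nat (ρ 1)
    · refine tendsto_nhds_unique (hlim (g ^ k)) ?_
      have h₁ := ((hlim g).comp (tendsto_id.const_mul_atTop' hk)).const_mul (k : ℝ)
      refine h₁.congr' ?_
      filter_upwards [eventually_gt_atTop 0] with m hm
      have : (k : ℝ) ≠ 0 := by positivity
      have : (m : ℝ) ≠ 0 := by positivity
      simp only [Function.comp, id, pow_mul]
      push_cast
      field_simp
  · refine tendsto_nhds_unique (hlim g) (tendsto_const_nhds.congr' ?_)
    filter_upwards [eventually_gt_atTop 0] with m hm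
    have : (m : ℝ) ≠ 0 := by positivity
    rw [hg]
    field_simp

/-! ### Homotopies of based paths -/

namespace UniversalCover

open unitInterval

variable {G : Type*} [Group G] [TopologicalSpace G] [IsTopologicalGroup G]

/-- The class of a path that starts at the identity. -/
def mk (γ : C(I, G)) (h : γ 0 = 1) : UniversalCover G :=
  ((⟨γ, h⟩ : basedPaths G) : (pathHomotopyCon G).Quotient)

theorem exists_eq_mk (g : UniversalCover G) : ∃ γ h, g = mk γ h := by
  induction g using Con.induction_on with
  | H γ => exact ⟨γ.1, γ.2, rfl⟩

theorem endpoint_mk (γ : C(I, G)) (h : γ 0 = 1) : endpoint G (mk γ h) = γ 1 := rfl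

theorem one_eq_mk : (1 : UniversalCover G) = mk 1 rfl := rfl

theorem mk_mul_mk {γ δ : C(I, G)} (hγ : γ 0 = 1) (hδ : δ 0 = 1) :
    mk γ hγ * mk δ hδ = mk (γ * δ) (by simp [hγ, hδ]) := rfl

theorem mk_inv {γ : C(I, G)} (hγ : γ 0 = 1) :
    (mk γ hγ)⁻¹ = mk γ⁻¹ (by simp [hγ]) := rfl

theorem mk_pow {γ : C(I, G)} (hγ : γ 0 = 1) (k : ℕ) :
    mk γ hγ ^ k = mk (γ ^ k) (by simp [hγ]) := rfl

theorem mk_eq_mk_iff {γ δ : C(I, G)} {hγ : γ 0 = 1} {hδ : δ 0 = 1} :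
    mk γ hγ = mk δ hδ ↔ γ.HomotopicRel δ {0, 1} :=
  Con.eq _

theorem mk_eq_mk {γ δ : C(I, G)} {hγ : γ 0 = 1} {hδ : δ 0 = 1} (F : I → I → G)
    (hF : Continuous fun p : I × I => F p.1 p.2) (h₀ : ∀ t, F 0 t = γ t) (h₁ : ∀ t, F 1 t = δ t)
    (hl : ∀ s, F s 0 = 1) (hr : ∀ s, F s 1 = γ 1) : mk γ hγ = mk δ hδ := by
  refine mk_eq_mk_iff.mpr ⟨⟨⟨⟨_, hF⟩, h₀, h₁⟩, ?_⟩⟩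
  rintro s t (rfl | rfl)
  · exact (hl s).trans hγ.symm
  · exact hr s

/-- Reparametrizing a path does not change its class. -/
theorem mk_comp {γ : C(I, G)} (hγ : γ 0 = 1) (r : C(I, I)) (h₀ : r 0 = 0) (h₁ : r 1 = 1) :
    mk γ hγ = mk (γ.comp r) (by simp [h₀, hγ]) := by
  let q : I → I → I := fun s t => Set.projIcc 0 1 zero_le_one ((1 - (s : ℝ)) * t + s * r t)
  refine mk_eq_mk (fun s t => γ (q s t)) ?_ (fun t => ?_) (fun t => ?_) (fun s => ?_) fun s => ?_
  · exact γ.continuous.comp (continuous_projIcc.comp (by fun_prop))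
  · simp [q]
  · simp [q]
  · simp [q, h₀, hγ]
  · simp [q, h₁]

/-- The kernel of the endpoint homomorphism is central. -/
theorem commute_of_endpoint_eq_one {z : UniversalCover G} (hz : endpoint G z = 1)
    (g : UniversalCover G) : Commute z g := by
  obtain ⟨ζ, hζ, rfl⟩ := exists_eq_mk z
  obtain ⟨γ, hγ, rfl⟩ := exists_eq_mk g
  rw [endpoint_mk] at hz
  -- After reparametrization `ζ` moves only in the first half of the interval and `γ` only in the
  -- second, so at each time one of the two is the identity.
  let r : C(I, I) := ⟨fun t => Set.projIcc 0 1 zero_le_one (2 * (t : ℝ)),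
    continuous_projIcc.comp (by fun_prop)⟩
  let q : C(I, I) := ⟨fun t => Set.projIcc 0 1 zero_le_one (2 * (t : ℝ) - 1),
    continuous_projIcc.comp (by fun_prop)⟩
  have hr₀ : r 0 = 0 := by simp [r]
  have hr₁ : r 1 = 1 := Set.projIcc_of_right_le zero_le_one (by simp)
  have hq₀ : q 0 = 0 := Set.projIcc_of_le_left zero_le_one (by simp)
  have hq₁ : q 1 = 1 := Set.projIcc_of_right_le zero_le_one (by norm_num)
  rw [mk_comp hζ r hr₀ hr₁, mk_comp hγ q hq₀ hq₁, commute_iff_eq, mk_mul_mk, mk_mul_mk]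
  congr 1
  ext t
  change ζ (r t) * γ (q t) = γ (q t) * ζ (r t)
  rcases le_total (t : ℝ) (1 / 2) with ht | ht
  · have : q t = 0 := Set.projIcc_of_le_left zero_le_one (by linarith)
    rw [this, hγ, one_mul, mul_one]
  · have : r t = 1 := Set.projIcc_of_right_le zero_le_one (by linarith)
    rw [this, hz, one_mul, mul_one]

/-- Conjugation in the universal cover only depends on the endpoint. -/
theorem conj_mk {η γ : C(I, G)} (hη : η 0 = 1) (hγ : γ 0 = 1) :
    mk η hη * mk γ hγ * (mk η hη)⁻¹ =
      mk (ContinuousMap.const I (η 1) * γ * (ContinuousMap.const I (η 1))⁻¹)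
        (by simp [hγ]) := by
  rw [mk_inv, mk_mul_mk, mk_mul_mk]
  -- `η (max s t)` interpolates between `η t` and the constant `η 1`; at `t = 0` the conjugate is
  -- trivial because `γ 0 = 1`.
  refine mk_eq_mk (fun s t => η (max s t) * γ t * (η (max s t))⁻¹) ?_ (fun t => ?_) (fun t => ?_)
    (fun s => ?_) fun s => ?_
  · fun_prop
  · simp
  · have : max (1 : I) t = 1 := max_eq_left t.2.2
    simp [this]
  · simp [hγ]
  · have : max s (1 : I) = 1 := max_eq_right s.2.2
    simp [this]

end UniversalCover

/-! ### Complex matrices as real matrices of twice the size -/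

section Realify

open Matrix

open scoped ComplexConjugate

variable {m : Type*}

/-- The real matrix with blocks `(X, -Y)` and `(Y, X)` attached to `X + iY`. -/
def realify (U : Matrix m m ℂ) : Matrix (m ⊕ m) (m ⊕ m) ℝ :=
  fromBlocks (U.map Complex.re) (-U.map Complex.im) (U.map Complex.im) (U.map Complex.re)

/-- The complex linear part of a real matrix acting on `ℝᵐ ⊕ ℝᵐ ≅ ℂᵐ`. -/
noncomputable def complexPart (A : Matrix (m ⊕ m) (m ⊕ m) ℝ) : Matrix m m ℂ :=
  of fun i j => ⟨(A (.inl i) (.inl j) + A (.inr i) (.inr j)) / 2,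
    (A (.inr i) (.inl j) - A (.inl i) (.inr j)) / 2⟩

/-- The complex antilinear part of a real matrix acting on `ℝᵐ ⊕ ℝᵐ ≅ ℂᵐ`. -/
noncomputable def antilinearPart (A : Matrix (m ⊕ m) (m ⊕ m) ℝ) : Matrix m m ℂ :=
  of fun i j => ⟨(A (.inl i) (.inl j) - A (.inr i) (.inr j)) / 2,
    (A (.inr i) (.inl j) + A (.inl i) (.inr j)) / 2⟩

@[fun_prop]
theorem continuous_realify : Continuous (realify : Matrix m m ℂ → _) := by
  unfold realify
  fun_prop

@[fun_prop]
theorem continuous_complexPart :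
    Continuous (complexPart : Matrix (m ⊕ m) (m ⊕ m) ℝ → Matrix m m ℂ) := by
  refine continuous_matrix fun i j => ?_
  have h : ∀ A : Matrix (m ⊕ m) (m ⊕ m) ℝ, complexPart A i j =
      ((A (.inl i) (.inl j) + A (.inr i) (.inr j)) / 2 : ℝ) +
        ((A (.inr i) (.inl j) - A (.inl i) (.inr j)) / 2 : ℝ) * Complex.I :=
    fun A => Complex.mk_eq_add_mul_I _ _
  simp only [h]
  fun_prop

@[fun_prop]
theorem continuous_antilinearPart :
    Continuous (antilinearPart : Matrix (m ⊕ m) (m ⊕ m) ℝ → Matrix m m ℂ) := by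
  refine continuous_matrix fun i j => ?_
  have h : ∀ A : Matrix (m ⊕ m) (m ⊕ m) ℝ, antilinearPart A i j =
      ((A (.inl i) (.inl j) - A (.inr i) (.inr j)) / 2 : ℝ) +
        ((A (.inr i) (.inl j) + A (.inl i) (.inr j)) / 2 : ℝ) * Complex.I :=
    fun A => Complex.mk_eq_add_mul_I _ _
  simp only [h]
  fun_prop

theorem complexPart_realify (U : Matrix m m ℂ) : complexPart (realify U) = U := by
  ext i j
  apply Complex.ext <;> simp [complexPart, realify]

theorem antilinearPart_realify (U : Matrix m m ℂ) : antilinearPart (realify U) = 0 := by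
  ext i j
  apply Complex.ext <;> simp [antilinearPart, realify]

theorem realify_complexPart {A : Matrix (m ⊕ m) (m ⊕ m) ℝ} (h : antilinearPart A = 0) :
    realify (complexPart A) = A := by
  have hre : ∀ i j, (A (.inl i) (.inl j) - A (.inr i) (.inr j)) / 2 = 0 :=
    fun i j => congrArg Complex.re (congrFun₂ h i j)
  have him : ∀ i j, (A (.inr i) (.inl j) + A (.inl i) (.inr j)) / 2 = 0 :=
    fun i j => congrArg Complex.im (congrFun₂ h i j)
  ext (i | i) (j | j) <;> simp [realify, complexPart] <;> linarith [hre i j, him i j]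

theorem complexPart_transpose (A : Matrix (m ⊕ m) (m ⊕ m) ℝ) :
    complexPart Aᵀ = (complexPart A)ᴴ := by
  ext i j
  apply Complex.ext <;> simp [complexPart]
  ring

theorem antilinearPart_transpose (A : Matrix (m ⊕ m) (m ⊕ m) ℝ) :
    antilinearPart Aᵀ = (antilinearPart A)ᵀ := by
  ext i j
  apply Complex.ext <;> simp [antilinearPart]
  ring

theorem realify_conjTranspose (U : Matrix m m ℂ) : realify Uᴴ = (realify U)ᵀ := by
  ext (i | i) (j | j) <;> simp [realify]

section Mul

variable [Fintype m]

theorem realify_mul (U V : Matrix m m ℂ) : realify (U * V) = realify U * realify V := by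
  ext (i | i) (j | j) <;>
    simp [realify, mul_apply, Finset.sum_sub_distrib, Finset.sum_add_distrib] <;>
    ring

/-- Compose `z ↦ a z + b z̄` with `z ↦ a' z + b' z̄` and collect the terms in `z`; those in `z̄`
give `antilinearPart_mul`. -/
theorem complexPart_mul (A B : Matrix (m ⊕ m) (m ⊕ m) ℝ) :
    complexPart (A * B) =
      complexPart A * complexPart B + antilinearPart A * (antilinearPart B).map conj := by
  ext i j
  apply Complex.ext <;>
  · simp only [complexPart, antilinearPart, mul_apply, of_apply, Matrix.add_apply, map_apply,
      Fintype.sum_sum_type, Complex.add_re, Complex.add_im, Complex.re_sum, Complex.im_sum,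
      Complex.mul_re, Complex.mul_im, Complex.conj_re, Complex.conj_im, ← Finset.sum_add_distrib,
      ← Finset.sum_sub_distrib, Finset.sum_div]
    exact Finset.sum_congr rfl fun k _ => by ring

theorem antilinearPart_mul (A B : Matrix (m ⊕ m) (m ⊕ m) ℝ) :
    antilinearPart (A * B) =
      complexPart A * antilinearPart B + antilinearPart A * (complexPart B).map conj := by
  ext i j
  apply Complex.ext <;>
  · simp only [complexPart, antilinearPart, mul_apply, of_apply, Matrix.add_apply, map_apply,
      Fintype.sum_sum_type, Complex.add_re, Complex.add_im, Complex.re_sum, Complex.im_sum,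
      Complex.mul_re, Complex.mul_im, Complex.conj_re, Complex.conj_im, ← Finset.sum_add_distrib,
      ← Finset.sum_sub_distrib, Finset.sum_div]
    exact Finset.sum_congr rfl fun k _ => by ring

end Mul

variable [DecidableEq m]

theorem realify_one : realify (1 : Matrix m m ℂ) = 1 := by
  ext (i | i) (j | j) <;> simp [realify, one_apply, apply_ite]

theorem complexPart_one : complexPart (1 : Matrix (m ⊕ m) (m ⊕ m) ℝ) = 1 := by
  rw [← realify_one, complexPart_realify]

theorem antilinearPart_one : antilinearPart (1 : Matrix (m ⊕ m) (m ⊕ m) ℝ) = 0 := by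
  rw [← realify_one, antilinearPart_realify]

theorem realify_I : realify (Complex.I • (1 : Matrix m m ℂ)) = J m ℝ := by
  ext (i | i) (j | j) <;> simp [realify, J, one_apply, apply_ite]

variable [Fintype m]

/-- The complex linear part `a` and antilinear part `b` of a symplectic matrix satisfy
`a aᴴ = 1 + b bᴴ`. -/
theorem complexPart_mul_conjTranspose {A : Matrix (m ⊕ m) (m ⊕ m) ℝ}
    (hA : A ∈ symplecticGroup m ℝ) :
    complexPart A * (complexPart A)ᴴ = 1 + antilinearPart A * (antilinearPart A)ᴴ := by
  -- The linear part of `A J Aᵀ = J`, with `J` acting as `i`, is `i a aᴴ - i b bᴴ = i`; the sign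
  -- comes from `conj i = -i`.
  have h := congrArg complexPart (SymplecticGroup.mem_iff.mp hA)
  have hI : (Complex.I • (1 : Matrix m m ℂ)) * (Complex.I • 1) = -1 := by
    rw [smul_mul_smul_comm, Complex.I_mul_I, mul_one, neg_smul, one_smul]
  have h₁ := congrArg (· * (-(Complex.I • (1 : Matrix m m ℂ)))) h
  simp only [complexPart_mul, antilinearPart_mul, ← realify_I, complexPart_realify,
    antilinearPart_realify, complexPart_transpose, antilinearPart_transpose, mul_neg, hI,
    neg_neg] at h₁
  have h₂ : (antilinearPart A)ᵀ.map conj = (antilinearPart A)ᴴ := rfl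
  rw [h₂] at h₁
  have h₃ : (Complex.I • (1 : Matrix m m ℂ)).map conj = -(Complex.I • (1 : Matrix m m ℂ)) := by
    ext i j
    simp [one_apply, apply_ite]
  rw [h₃] at h₁
  simp only [map_zero, mul_zero, add_zero, zero_add, Matrix.map_zero, mul_neg, neg_mul,
    Matrix.smul_mul, Matrix.mul_smul, mul_one, smul_add, smul_neg, smul_smul, Complex.I_mul_I,
    neg_smul, one_smul, neg_neg, neg_add] at h₁
  rw [← h₁]
  abel

/-- The complex linear part `a` and antilinear part `b` of a symplectic matrix satisfy
`aᴴ a = 1 + bᵀ b̄`. -/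
theorem conjTranspose_mul_complexPart {A : Matrix (m ⊕ m) (m ⊕ m) ℝ}
    (hA : A ∈ symplecticGroup m ℝ) :
    (complexPart A)ᴴ * complexPart A =
      1 + ((antilinearPart A).map conj)ᴴ * (antilinearPart A).map conj := by
  have h := complexPart_mul_conjTranspose (SymplecticGroup.transpose_mem hA)
  rw [complexPart_transpose, antilinearPart_transpose, conjTranspose_conjTranspose] at h
  have h₁ : ((antilinearPart A).map conj)ᴴ = (antilinearPart A)ᵀ := by
    ext i j
    simp
  rw [h₁]
  exact h

theorem realify_mem_symplecticGroup {U : Matrix m m ℂ} (hU : U ∈ unitary (Matrix m m ℂ)) :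
    realify U ∈ symplecticGroup m ℝ := by
  rw [SymplecticGroup.mem_iff, ← realify_I, ← realify_conjTranspose, ← realify_mul, ← realify_mul]
  congr 1
  rw [Matrix.mul_smul, mul_one, Matrix.smul_mul]
  congr 1
  exact (Unitary.mem_iff.mp hU).2

theorem realify_mem_orthogonalGroup {U : Matrix m m ℂ} (hU : U ∈ unitary (Matrix m m ℂ)) :
    realify U ∈ orthogonalGroup (m ⊕ m) ℝ := by
  rw [mem_orthogonalGroup_iff]
  change realify U * (realify U)ᵀ = 1
  rw [← realify_conjTranspose, ← realify_mul, ← realify_one]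
  congr 1
  exact (Unitary.mem_iff.mp hU).2

/-- A symplectic orthogonal matrix is complex linear. -/
theorem antilinearPart_eq_zero {A : Matrix (m ⊕ m) (m ⊕ m) ℝ} (hA : A ∈ symplecticGroup m ℝ)
    (hA' : A ∈ orthogonalGroup (m ⊕ m) ℝ) : antilinearPart A = 0 := by
  have h₁ : Aᵀ * A = 1 := (mem_orthogonalGroup_iff' _ _).mp hA'
  -- Orthogonality turns the symplectic relation into commutation with `J`, whose antilinear part
  -- reads `-i b = i b`.
  have h : A * J m ℝ = J m ℝ * A := by
    nth_rewrite 2 [← SymplecticGroup.mem_iff.mp hA]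
    rw [mul_assoc (A * J m ℝ), h₁, mul_one]
  have h₂ := congrArg antilinearPart h
  simp only [antilinearPart_mul, ← realify_I, complexPart_realify, antilinearPart_realify,
    mul_zero, zero_mul, zero_add, add_zero] at h₂
  have h₃ : (Complex.I • (1 : Matrix m m ℂ)).map conj = -(Complex.I • (1 : Matrix m m ℂ)) := by
    ext i j
    simp [one_apply, apply_ite]
  rw [h₃, mul_neg, Matrix.mul_smul, mul_one, Matrix.smul_mul, one_mul] at h₂
  have h₄ := congrArg (Complex.I • ·) h₂
  simp only [smul_neg, smul_smul, Complex.I_mul_I, neg_smul, one_smul, neg_neg] at h₄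
  ext i j
  have h₅ := congrFun₂ h₄ i j
  simp only [Matrix.neg_apply] at h₅
  exact self_eq_neg.mp h₅

theorem complexPart_mem_unitary {A : Matrix (m ⊕ m) (m ⊕ m) ℝ} (hA : A ∈ symplecticGroup m ℝ)
    (hA' : A ∈ orthogonalGroup (m ⊕ m) ℝ) : complexPart A ∈ unitary (Matrix m m ℂ) := by
  have h := antilinearPart_eq_zero hA hA'
  have h₁ := complexPart_mul_conjTranspose hA
  have h₂ := conjTranspose_mul_complexPart hA
  rw [h] at h₁ h₂
  rw [Unitary.mem_iff]
  exact ⟨h₂.trans (by simp), h₁.trans (by simp)⟩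

end Realify

/-- The inclusion of the unitary group into the symplectic group. -/
def unitaryToSp (n : ℕ) : unitary (Matrix (Fin n) (Fin n) ℂ) →* Sp n where
  toFun U := ⟨realify U, realify_mem_symplecticGroup U.2⟩
  map_one' := Subtype.ext realify_one
  map_mul' _ _ := Subtype.ext (realify_mul _ _)

theorem continuous_unitaryToSp (n : ℕ) : Continuous (unitaryToSp n) :=
  (continuous_realify.comp continuous_subtype_val).subtype_mk _

/-! ### Vanishing on paths of unitary matrices -/

open unitInterval in
/-- Let `ρ` be a homogeneous quasimorphism on the universal cover of `G` and let `φ : U → G` be a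
continuous homomorphism. If every point of `U` has a neighbourhood whose points can be joined to
the identity, continuously, by paths on whose images `ρ` vanishes, then `ρ` vanishes on the image
of every path in `U`. -/
theorem IsHomogeneousQuasimorphism.mk_comp_eq_zero
    {U G : Type*} [Group U] [TopologicalSpace U] [IsTopologicalGroup U]
    [Group G] [TopologicalSpace G] [IsTopologicalGroup G]
    {ρ : UniversalCover G → ℝ} (hρ : IsHomogeneousQuasimorphism ρ) (φ : C(U, G))
    (hφ₁ : φ 1 = 1) (hφ : ∀ x y, φ (x * y) = φ x * φ y)
    (h : ∀ u₀ : U, ∃ W : Set U, IsOpen W ∧ u₀ ∈ W ∧ ∃ E : W → C(I, U),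
      Continuous (fun p : I × W => E p.2 p.1) ∧
      ∀ w, E w 1 = w ∧ ∃ h₀ : E w 0 = 1,
        ρ (UniversalCover.mk (φ.comp (E w)) (by simp [h₀, hφ₁])) = 0)
    (u : C(I, U)) (hu : u 0 = 1) :
    ρ (UniversalCover.mk (φ.comp u) (by simp [hu, hφ₁])) = 0 := by
  -- `q t` is `u` restricted to `[0, t]`; the value of `ρ` on it will be locally constant in `t`.
  let q : I → C(I, U) := fun t => ⟨fun s => u (t * s), by fun_prop⟩
  have hq : ∀ t, φ.comp (q t) 0 = 1 := fun t => by simp [q, hu, hφ₁]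
  let f : I → ℝ := fun t => ρ (UniversalCover.mk (φ.comp (q t)) (hq t))
  have hlc : IsLocallyConstant f := by
    rw [IsLocallyConstant.iff_eventually_eq]
    intro t₀
    obtain ⟨W, hW, hW₀, E, hE, hE'⟩ := h (u t₀)
    obtain ⟨ε, hε, hball⟩ := Metric.isOpen_iff.mp (hW.preimage u.continuous) t₀ hW₀
    -- Dividing by the chosen path to `u t` leaves a loop, whose class is central, so `ρ` is
    -- additive on this product.
    have key : ∀ t (ht : u t ∈ W), ∃ h₁ : φ.comp (q t * (E ⟨u t, ht⟩)⁻¹) 0 = 1,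
        f t = ρ (UniversalCover.mk (φ.comp (q t * (E ⟨u t, ht⟩)⁻¹)) h₁) := by
      intro t ht
      obtain ⟨h₁, h₀, h₂⟩ := hE' ⟨u t, ht⟩
      refine ⟨by simp [q, hu, h₀, hφ₁], ?_⟩
      have hz : UniversalCover.mk (φ.comp (q t * (E ⟨u t, ht⟩)⁻¹)) (by simp [q, hu, h₀, hφ₁]) *
          UniversalCover.mk (φ.comp (E ⟨u t, ht⟩)) (by simp [h₀, hφ₁]) =
          UniversalCover.mk (φ.comp (q t)) (hq t) := by
        rw [UniversalCover.mk_mul_mk]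
        congr 1
        ext s
        simp [← hφ]
      change ρ _ = ρ _
      rw [← hz, hρ.map_mul_of_commute, h₂, add_zero]
      refine UniversalCover.commute_of_endpoint_eq_one ?_ _
      rw [UniversalCover.endpoint_mk]
      simp [q, h₁, hφ₁]
    filter_upwards [Metric.ball_mem_nhds t₀ hε] with t ht
    obtain ⟨h₁, h₂⟩ := key t (hball ht)
    obtain ⟨h₃, h₄⟩ := key t₀ hW₀
    rw [h₂, h₄]
    congr 1
    -- Along the segment from `t` to `t₀` the point stays in `W`, so the two loops are homotopic
    -- through loops.
    obtain ⟨τ, hτ⟩ : ∃ τ : C(I, I), ∀ r, (τ r : ℝ) = (1 - (r : ℝ)) * t + r * t₀ := by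
      refine ⟨⟨fun r => Set.projIcc 0 1 zero_le_one ((1 - (r : ℝ)) * t + r * t₀),
        continuous_projIcc.comp (by fun_prop)⟩, fun r => ?_⟩
      have : (1 - (r : ℝ)) * t + r * t₀ ∈ I :=
        (convex_Icc (0 : ℝ) 1) t.2 t₀.2 (sub_nonneg.mpr r.2.2) r.2.1 (sub_add_cancel _ _)
      simp [Set.projIcc_of_mem _ this]
    have hτ₀ : τ 0 = t := Subtype.ext (by simp [hτ])
    have hτ₁ : τ 1 = t₀ := Subtype.ext (by simp [hτ])
    have hτW : ∀ r, u (τ r) ∈ W := by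
      intro r
      apply hball
      rw [Metric.mem_ball, Subtype.dist_eq, Real.dist_eq] at ht ⊢
      have : (τ r : ℝ) - t₀ = (1 - r) * (t - t₀) := by rw [hτ]; ring
      rw [this, abs_mul, abs_of_nonneg (sub_nonneg.mpr r.2.2)]
      nlinarith [abs_nonneg ((t : ℝ) - t₀), r.2.1]
    refine UniversalCover.mk_eq_mk
      (fun r s => φ (q (τ r) s * (E ⟨u (τ r), hτW r⟩ s)⁻¹)) ?_ ?_ ?_ ?_ ?_
    · have : Continuous fun p : I × I => E ⟨u (τ p.1), hτW p.1⟩ p.2 :=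
        hE.comp (f := fun p : I × I => (p.2, (⟨u (τ p.1), hτW p.1⟩ : W))) (by fun_prop)
      simp only [q, ContinuousMap.coe_mk]
      exact φ.continuous.comp (Continuous.mul (by fun_prop) this.inv)
    · intro s
      simp [hτ₀]
    · intro s
      simp [hτ₁]
    · intro r
      simp [q, hu, (hE' _).2.1, hφ₁]
    · intro r
      simp [q, (hE' _).1]
  have h₁ := hlc.apply_eq_of_preconnectedSpace 1 0
  have h₂ : f 0 = 0 := by
    have : UniversalCover.mk (φ.comp (q 0)) (hq 0) = 1 := by
      rw [UniversalCover.one_eq_mk]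
      congr 1
      ext s
      simp [q, hu, hφ₁]
    change ρ _ = 0
    rw [this, hρ.map_one]
  rw [h₂] at h₁
  convert h₁ using 4
  ext s
  simp [q]

/-! ### Continuous local logarithms on the unitary group. -/

section LocalLogarithm

open Matrix.Norms.L2Operator Unitary selfAdjoint

variable {m : Type*} [Fintype m] [DecidableEq m]

theorem expUnitary_nsmul (k : ℕ) (x : selfAdjoint (Matrix m m ℂ)) :
    expUnitary (k • x) = expUnitary x ^ k := by
  induction k with
  | zero => simp
  | succ k ih =>
    rw [succ_nsmul, pow_succ, ← ih]
    refine Commute.expUnitary_add ?_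
    rw [AddSubgroup.coe_nsmul]
    exact (Commute.refl (x : Matrix m m ℂ)).smul_left k

/-- The spectrum is finite and `θ ∈ [0, 1]` gives infinitely many points. Multiplying by `exp(-iθ)`
then keeps `-1`, where the argument jumps, out of the spectrum. -/
theorem exists_circle_mul_notMem_spectrum (U : Matrix m m ℂ) :
    ∃ θ : ℝ, -Complex.exp (Complex.I * θ) ∉ spectrum ℂ U := by
  have hfin : (spectrum ℂ U).Finite := Matrix.finite_spectrum U
  by_contra! hcon
  have hinj : Set.InjOn (fun θ : ℝ => -Complex.exp (Complex.I * θ)) (Set.Icc 0 1) := by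
    intro x hx y hy hxy
    refine Circle.exp_injOn_Icc (by linarith [Real.pi_gt_three]) hx hy (Circle.ext ?_)
    rw [Circle.coe_exp, Circle.coe_exp, mul_comm, mul_comm (y : ℂ)]
    exact neg_injective hxy
  exact (Set.Icc_infinite (zero_lt_one' ℝ)).image hinj (hfin.subset (by
    rintro _ ⟨θ, -, rfl⟩
    exact hcon θ))

/-- Locally on the unitary group the exponential map has a continuous section. -/
theorem exists_local_logarithm (u₀ : unitary (Matrix m m ℂ)) :
    ∃ W : Set (unitary (Matrix m m ℂ)), IsOpen W ∧ u₀ ∈ W ∧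
      ∃ L : W → selfAdjoint (Matrix m m ℂ), Continuous L ∧ ∀ w, expUnitary (L w) = w := by
  obtain ⟨θ, hθ⟩ := exists_circle_mul_notMem_spectrum (u₀ : Matrix m m ℂ)
  let c : ℝ → unitary (Matrix m m ℂ) := fun r => expUnitary (r • 1)
  have hcomm : ∀ (r : ℝ) (x : Matrix m m ℂ),
      Commute ((r • (1 : selfAdjoint (Matrix m m ℂ)) : selfAdjoint (Matrix m m ℂ)) :
        Matrix m m ℂ) x := by
    intro r x
    change Commute (r • (1 : Matrix m m ℂ)) x
    exact (Commute.one_left x).smul_left r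
  have hc : ∀ r, (c r : Matrix m m ℂ) = Complex.exp (Complex.I * r) • 1 := by
    intro r
    change NormedSpace.exp (Complex.I • (r • (1 : Matrix m m ℂ))) = _
    have h : Complex.I • (r • (1 : Matrix m m ℂ)) =
        algebraMap ℂ (Matrix m m ℂ) (Complex.I * r) := by
      rw [Algebra.algebraMap_eq_smul_one, mul_smul, Complex.coe_smul]
    rw [h, ← NormedSpace.algebraMap_exp_comm, Algebra.algebraMap_eq_smul_one, Complex.exp_eq_exp_ℂ]
  have hcc : c θ * c (-θ) = 1 := by
    rw [← (hcomm θ _).expUnitary_add, ← add_smul, add_neg_cancel, zero_smul, expUnitary_zero]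
  refine ⟨{u | c (-θ) * u ∈ Metric.ball 1 2}, ?_, ?_, ?_⟩
  · exact Metric.isOpen_ball.preimage (continuous_const.mul continuous_id)
  · rw [Set.mem_ofPred_eq, Metric.mem_ball, Subtype.dist_eq, dist_eq_norm]
    refine (norm_sub_one_lt_two_iff (c (-θ) * u₀).2).mpr fun hmem => hθ ?_
    have h := spectrum.smul_mem_smul_iff (a := (u₀ : Matrix m m ℂ))
      (s := -Complex.exp (Complex.I * θ)) (r := Units.mk0 _ (Complex.exp_ne_zero (Complex.I * (-θ))))
    refine h.mp ?_
    convert hmem using 1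
    · change _ = spectrum ℂ ((c (-θ) : Matrix m m ℂ) * u₀)
      rw [hc, Matrix.smul_mul, one_mul, Complex.ofReal_neg]
      rfl
    · rw [Units.smul_def, Units.val_mk0, smul_eq_mul, mul_neg, ← Complex.exp_add]
      simp
  · refine ⟨fun w => θ • 1 + argSelfAdjoint (c (-θ) * w.1), ?_, fun w => ?_⟩
    · refine continuous_const.add ?_
      exact continuousOn_argSelfAdjoint.comp_continuous (by fun_prop) fun w => w.2
    · have hw := w.2
      rw [Set.mem_ofPred_eq, Metric.mem_ball, Subtype.dist_eq, dist_eq_norm] at hw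
      rw [(hcomm θ _).expUnitary_add, expUnitary_argSelfAdjoint hw]
      change c θ * _ = _
      rw [← mul_assoc, hcc, one_mul]

end LocalLogarithm

open Matrix.Norms.L2Operator selfAdjoint unitInterval in
/-- A homogeneous quasimorphism on the universal cover of `Sp(2n)` with integral values over the
unitary group vanishes on paths in the unitary group. -/
theorem IsHomogeneousQuasimorphism.mk_unitaryToSp_eq_zero {n : ℕ}
    {ρ : UniversalCover (Sp n) → ℝ} (hρ : IsHomogeneousQuasimorphism ρ)
    (hint : ∀ (g : UniversalCover (Sp n)) (U : unitary (Matrix (Fin n) (Fin n) ℂ)),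
      UniversalCover.endpoint (Sp n) g = unitaryToSp n U → ∃ k : ℤ, ρ g = k)
    (u : C(I, unitary (Matrix (Fin n) (Fin n) ℂ))) (hu : u 0 = 1) :
    ρ (UniversalCover.mk (ContinuousMap.comp ⟨unitaryToSp n, continuous_unitaryToSp n⟩ u)
      (by simp [hu])) = 0 := by
  refine hρ.mk_comp_eq_zero ⟨unitaryToSp n, continuous_unitaryToSp n⟩ (_root_.map_one (unitaryToSp n))
    (_root_.map_mul (unitaryToSp n)) (fun u₀ => ?_) u hu
  obtain ⟨W, hW, hW₀, L, hL, hexp⟩ := exists_local_logarithm u₀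
  refine ⟨W, hW, hW₀, fun w => ⟨fun t => expUnitary ((t : ℝ) • L w), by fun_prop⟩,
    by simp only [ContinuousMap.coe_mk]; fun_prop, fun w => ⟨by simp [hexp], by simp, ?_⟩⟩
  refine hρ.eq_zero_of_divisible fun k => ?_
  -- The pointwise `(k + 1)`-th root of the one-parameter path; its endpoint is again unitary, so
  -- `ρ` is integral on it.
  let v : C(I, unitary (Matrix (Fin n) (Fin n) ℂ)) :=
    ⟨fun t => expUnitary ((t : ℝ) • ((k + 1 : ℕ) : ℝ)⁻¹ • L w), by fun_prop⟩
  have hv : v 0 = 1 := by simp [v]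
  obtain ⟨j, hj⟩ := hint (UniversalCover.mk
    (ContinuousMap.comp ⟨unitaryToSp n, continuous_unitaryToSp n⟩ v) (by simp [hv])) (v 1) rfl
  refine ⟨_, j, ?_, hj⟩
  rw [UniversalCover.mk_pow]
  congr 1
  ext1 t
  change unitaryToSp n (v t) ^ (k + 1) = unitaryToSp n (expUnitary ((t : ℝ) • L w))
  rw [← map_pow]
  congr 1
  change expUnitary ((t : ℝ) • ((k + 1 : ℕ) : ℝ)⁻¹ • L w) ^ (k + 1) = _
  rw [← expUnitary_nsmul, ← Nat.cast_smul_eq_nsmul ℝ, smul_comm, smul_smul _ _ (L w),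
    mul_inv_cancel₀ (by positivity), one_smul]

/-! ### Polar decomposition of symplectic matrices -/

section Sqrt

open Matrix MatrixOrder

variable {m : Type*} [Fintype m] [DecidableEq m]

/-- The entrywise inclusion of real matrices into complex matrices. -/
def Matrix.complexify : Matrix m m ℝ →⋆ₐ[ℝ] Matrix m m ℂ :=
  { Complex.ofRealAm.mapMatrix with
    map_star' := fun A => by
      ext i j
      simp [Matrix.star_apply] }

theorem Matrix.complexify_apply (A : Matrix m m ℝ) (i j : m) :
    complexify A i j = A i j := rfl

theorem Matrix.isInducing_complexify :
    Topology.IsInducing (complexify : Matrix m m ℝ → Matrix m m ℂ) := by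
  have h : Continuous fun A : Matrix m m ℂ => A.map Complex.re := by fun_prop
  refine Topology.IsInducing.of_comp (g := fun A : Matrix m m ℂ => A.map Complex.re) ?_ h ?_
  · refine continuous_matrix fun i j => ?_
    simp only [complexify_apply]
    fun_prop
  · have h' : (fun A : Matrix m m ℂ => A.map Complex.re) ∘ complexify = id := by
      ext A i j
      simp [complexify_apply]
    rw [h']
    exact Topology.IsInducing.id

theorem Matrix.sqrt_eq_cfc_real_sqrt {A : Matrix m m ℝ} (hA : A.PosSemidef) :
    CFC.sqrt A = cfc Real.sqrt A := by
  rw [CFC.sqrt_eq_real_sqrt A hA.nonneg, cfcₙ_eq_cfc]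

-- Continuity of the functional calculus is used for complex matrices and pulled back along the
-- entrywise inclusion, which is inducing and commutes with the calculus.
open Matrix.Norms.L2Operator in
theorem Matrix.continuous_sqrt {X : Type*} [TopologicalSpace X] {A : X → Matrix m m ℝ}
    (hA : Continuous A) (hpos : ∀ x, (A x).PosSemidef) : Continuous fun x => CFC.sqrt (A x) := by
  rw [isInducing_complexify.continuous_iff]
  have hsa : ∀ x, IsSelfAdjoint (complexify (A x)) := fun x =>
    IsSelfAdjoint.map (hpos x).1 complexify
  have h : ∀ x, complexify (CFC.sqrt (A x)) = cfc Real.sqrt (complexify (A x)) := fun x => by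
    rw [sqrt_eq_cfc_real_sqrt (hpos x)]
    exact StarAlgHom.map_cfc (S := ℝ) complexify Real.sqrt (A x)
      (hφ := isInducing_complexify.continuous) (ha := (hpos x).1) (hφa := hsa x)
  simp only [Function.comp_def, h]
  exact Continuous.cfc_of_mem_nhdsSet (s := Set.univ) Real.sqrt Filter.univ_mem
    (isInducing_complexify.continuous.comp hA) hsa (by fun_prop)

end Sqrt

/-! ### The positive and orthogonal factors of a symplectic matrix. -/

section Polar

open Matrix MatrixOrder

variable {m : Type*} [Fintype m] [DecidableEq m]

theorem posDef_transpose_mul_self {A : Matrix (m ⊕ m) (m ⊕ m) ℝ} (hA : A ∈ symplecticGroup m ℝ) :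
    (Aᵀ * A).PosDef := by
  have h := posSemidef_conjTranspose_mul_self A
  rw [conjTranspose_eq_transpose_of_trivial] at h
  rw [h.posDef_iff_isUnit]
  have := (Matrix.isUnit_iff_isUnit_det A).mpr (SymplecticGroup.symplectic_det hA)
  exact ((isUnit_transpose A).mpr this).mul this

/-- The positive factor of the polar decomposition of a symplectic matrix is conjugate, by `J`, to
its inverse. -/
theorem J_mul_sqrt_mul_J {A : Matrix (m ⊕ m) (m ⊕ m) ℝ} (hA : A ∈ symplecticGroup m ℝ) :
    J m ℝ * CFC.sqrt (Aᵀ * A) * (J m ℝ)ᵀ = (CFC.sqrt (Aᵀ * A))⁻¹ := by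
  have hpos := posDef_transpose_mul_self hA
  rw [hpos.posSemidef.inv_sqrt]
  have hJ : (J m ℝ)ᵀ * J m ℝ = 1 := by rw [J_transpose, neg_mul, J_squared, neg_neg]
  -- Both sides are positive square roots of `(Aᵀ * A)⁻¹`, because `Aᵀ * A` is itself symplectic.
  refine (CFC.sqrt_unique ?_ ?_).symm
  · have hQ := SymplecticGroup.inv_eq_symplectic_inv (Aᵀ * A)
      (mul_mem (SymplecticGroup.transpose_mem hA) hA)
    rw [transpose_mul, transpose_transpose] at hQ
    calc J m ℝ * CFC.sqrt (Aᵀ * A) * (J m ℝ)ᵀ * (J m ℝ * CFC.sqrt (Aᵀ * A) * (J m ℝ)ᵀ)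
        = J m ℝ * (CFC.sqrt (Aᵀ * A) * ((J m ℝ)ᵀ * J m ℝ) * CFC.sqrt (Aᵀ * A)) * (J m ℝ)ᵀ := by
          simp only [mul_assoc]
      _ = (Aᵀ * A)⁻¹ := by
          rw [hJ, mul_one, CFC.sqrt_mul_sqrt_self _ hpos.posSemidef.nonneg, hQ, J_transpose]
          simp only [mul_neg, neg_mul]
  · have h := (CFC.sqrt_nonneg (Aᵀ * A)).posSemidef.mul_mul_conjTranspose_same (J m ℝ)
    rw [conjTranspose_eq_transpose_of_trivial] at h
    exact h.nonneg

theorem isUnit_det_sqrt {A : Matrix (m ⊕ m) (m ⊕ m) ℝ} (hA : A ∈ symplecticGroup m ℝ) :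
    IsUnit (CFC.sqrt (Aᵀ * A)).det := by
  have hpos := posDef_transpose_mul_self hA
  have h := CFC.sqrt_mul_sqrt_self _ hpos.posSemidef.nonneg
  have h₁ := hpos.isUnit
  rw [← h, Matrix.isUnit_iff_isUnit_det, det_mul] at h₁
  exact isUnit_of_mul_isUnit_left h₁

theorem transpose_sqrt (A : Matrix (m ⊕ m) (m ⊕ m) ℝ) :
    (CFC.sqrt (Aᵀ * A))ᵀ = CFC.sqrt (Aᵀ * A) := by
  have h := (CFC.sqrt_nonneg (Aᵀ * A)).posSemidef.1
  rwa [IsHermitian, conjTranspose_eq_transpose_of_trivial] at h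

theorem sqrt_mem_symplecticGroup {A : Matrix (m ⊕ m) (m ⊕ m) ℝ} (hA : A ∈ symplecticGroup m ℝ) :
    CFC.sqrt (Aᵀ * A) ∈ symplecticGroup m ℝ := by
  have hJ : (J m ℝ)ᵀ * J m ℝ = 1 := by rw [J_transpose, neg_mul, J_squared, neg_neg]
  rw [SymplecticGroup.mem_iff', transpose_sqrt]
  have h := congrArg (CFC.sqrt (Aᵀ * A) * · * J m ℝ) (J_mul_sqrt_mul_J hA)
  simp only [mul_nonsing_inv _ (isUnit_det_sqrt hA), one_mul] at h
  refine Eq.trans ?_ h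
  simp only [mul_assoc, hJ, mul_one]

theorem mul_sqrt_inv_mem_orthogonalGroup {A : Matrix (m ⊕ m) (m ⊕ m) ℝ}
    (hA : A ∈ symplecticGroup m ℝ) :
    A * (CFC.sqrt (Aᵀ * A))⁻¹ ∈ orthogonalGroup (m ⊕ m) ℝ := by
  have hpos := posDef_transpose_mul_self hA
  rw [mem_orthogonalGroup_iff']
  change (A * (CFC.sqrt (Aᵀ * A))⁻¹)ᵀ * (A * (CFC.sqrt (Aᵀ * A))⁻¹) = 1
  rw [transpose_mul, transpose_nonsing_inv, transpose_sqrt, mul_assoc, ← mul_assoc Aᵀ]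
  nth_rewrite 2 [← CFC.sqrt_mul_sqrt_self (Aᵀ * A) hpos.posSemidef.nonneg]
  rw [mul_assoc, mul_nonsing_inv _ (isUnit_det_sqrt hA), mul_one,
    nonsing_inv_mul _ (isUnit_det_sqrt hA)]

end Polar

-- The scalars `exp(iπt/2)` run from `1` to `i`, which is `J`. The path is what lifts conjugation by
-- `J` to the universal cover.
open unitInterval in
theorem exists_path_symJ (n : ℕ) :
    ∃ η : C(I, Sp n), η 0 = 1 ∧ η 1 = SymplecticGroup.symJ (Fin n) ℝ := by
  let z : ℝ → ℂ := fun t => Complex.exp (t * (Real.pi / 2 * Complex.I))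
  have hz : ∀ t, z t • (1 : Matrix (Fin n) (Fin n) ℂ) ∈ unitary (Matrix (Fin n) (Fin n) ℂ) := by
    intro t
    have h : star (z t) * z t = 1 := by
      change (starRingEnd ℂ) (z t) * z t = 1
      simp [z, ← Complex.exp_conj, ← Complex.exp_add, map_ofNat]
    rw [Unitary.mem_iff, star_smul, star_one, smul_mul_smul_comm, smul_mul_smul_comm, one_mul,
      h, mul_comm, h, one_smul]
    exact ⟨rfl, rfl⟩
  refine ⟨⟨fun t => unitaryToSp n ⟨_, hz t⟩, ?_⟩, ?_, ?_⟩
  · refine (continuous_unitaryToSp n).comp (Continuous.subtype_mk ?_ _)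
    fun_prop
  · refine Subtype.ext ?_
    change realify (z ((0 : I) : ℝ) • 1) = 1
    simp [z, realify_one]
  · refine Subtype.ext ?_
    change realify (z ((1 : I) : ℝ) • 1) = Matrix.J (Fin n) ℝ
    rw [← realify_I]
    simp [z, Complex.exp_pi_div_two_mul_I]

open Matrix MatrixOrder unitInterval in
/-- A homogeneous quasimorphism on the universal cover of `Sp(2n)` with integral values over the
unitary group vanishes. -/
theorem IsHomogeneousQuasimorphism.eq_zero_of_integral {n : ℕ}
    {ρ : UniversalCover (Sp n) → ℝ} (hρ : IsHomogeneousQuasimorphism ρ)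
    (hint : ∀ (g : UniversalCover (Sp n)) (U : unitary (Matrix (Fin n) (Fin n) ℂ)),
      UniversalCover.endpoint (Sp n) g = unitaryToSp n U → ∃ k : ℤ, ρ g = k)
    (g : UniversalCover (Sp n)) : ρ g = 0 := by
  obtain ⟨C, hC⟩ := hρ.1
  refine hρ.eq_zero_of_bounded (C := C) (fun g => ?_) g
  obtain ⟨γ, hγ, rfl⟩ := UniversalCover.exists_eq_mk g
  let P : C(I, Sp n) := ⟨fun t => ⟨_, sqrt_mem_symplecticGroup (γ t).2⟩, by
    refine (Matrix.continuous_sqrt ?_ fun t => (posDef_transpose_mul_self (γ t).2).posSemidef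
      ).subtype_mk _
    fun_prop⟩
  have hP₀ : P 0 = 1 := by
    refine Subtype.ext (CFC.sqrt_unique ?_ ?_)
    · simp [hγ]
    · exact PosSemidef.one.nonneg
  have hK : ∀ t, ((γ * P⁻¹) t : Matrix (Fin n ⊕ Fin n) (Fin n ⊕ Fin n) ℝ) ∈
      orthogonalGroup (Fin n ⊕ Fin n) ℝ := by
    intro t
    change (γ t : Matrix (Fin n ⊕ Fin n) (Fin n ⊕ Fin n) ℝ) * ((P t)⁻¹ : Sp n) ∈ _
    rw [SymplecticGroup.coe_inv']
    exact mul_sqrt_inv_mem_orthogonalGroup (γ t).2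
  let u : C(I, unitary (Matrix (Fin n) (Fin n) ℂ)) :=
    ⟨fun t => ⟨_, complexPart_mem_unitary ((γ * P⁻¹) t).2 (hK t)⟩, by fun_prop⟩
  have hu : ContinuousMap.comp ⟨unitaryToSp n, continuous_unitaryToSp n⟩ u = γ * P⁻¹ := by
    ext1 t
    exact Subtype.ext (realify_complexPart (antilinearPart_eq_zero ((γ * P⁻¹) t).2 (hK t)))
  have hu₀ : u 0 = 1 := by
    refine Subtype.ext ?_
    change complexPart (γ 0 * (P 0)⁻¹).1 = 1
    rw [hγ, hP₀, inv_one, mul_one]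
    exact complexPart_one
  have hρu := hρ.mk_unitaryToSp_eq_zero hint u hu₀
  have hρP : ρ (UniversalCover.mk P hP₀) = 0 := by
    obtain ⟨η, hη₀, hη₁⟩ := exists_path_symJ n
    -- Conjugation depends only on the endpoint `J`, which inverts each `P t`; conjugation
    -- invariance then gives `ρ [P] = -ρ [P]`.
    have hinv : UniversalCover.mk η hη₀ * UniversalCover.mk P hP₀ * (UniversalCover.mk η hη₀)⁻¹ =
        (UniversalCover.mk P hP₀)⁻¹ := by
      rw [UniversalCover.conj_mk, UniversalCover.mk_inv]
      congr 1
      ext1 t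
      change η 1 * P t * (η 1)⁻¹ = (P t)⁻¹
      refine Subtype.ext ?_
      rw [hη₁, SymplecticGroup.coe_inv']
      refine Eq.trans ?_ (J_mul_sqrt_mul_J (γ t).2)
      change J (Fin n) ℝ * _ * ((SymplecticGroup.symJ (Fin n) ℝ)⁻¹ : Sp n).1 = _
      rw [SymplecticGroup.coe_inv', SymplecticGroup.coe_J, J_inv, J_transpose]
      rfl
    have h₁ := hρ.map_conj (UniversalCover.mk P hP₀) (UniversalCover.mk η hη₀)
    rw [hinv, hρ.map_inv] at h₁
    linarith
  have hmul : UniversalCover.mk γ hγ =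
      UniversalCover.mk (ContinuousMap.comp ⟨unitaryToSp n, continuous_unitaryToSp n⟩ u)
        (by simp [hu₀]) * UniversalCover.mk P hP₀ := by
    rw [UniversalCover.mk_mul_mk]
    congr 1
    rw [hu, inv_mul_cancel_right]
  have h := hC (UniversalCover.mk (ContinuousMap.comp
    ⟨unitaryToSp n, continuous_unitaryToSp n⟩ u) (by simp [hu₀])) (UniversalCover.mk P hP₀)
  rwa [← hmul, hρu, hρP, sub_zero, sub_zero] at h

/-! ### Existence: the winding number of the determinant -/

section Det

open Matrix Matrix.Norms.L2Operator

open scoped ComplexConjugate ComplexOrder MatrixOrder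

variable {m : Type*} [Fintype m] [DecidableEq m]

/-- For `s ≠ 0` the determinant is `(-s)ⁿ χ(-1/s)`, with `χ` the characteristic polynomial of `K`
and `n` its degree. -/
theorem det_one_add_smul_eq_prod (K : Matrix m m ℂ) (s : ℂ) :
    (1 + s • K).det = (K.charpoly.roots.map fun z => 1 + s * z).prod := by
  rcases eq_or_ne s 0 with rfl | hs
  · simp
  have hsplit := IsAlgClosed.splits K.charpoly
  have hcard : K.charpoly.roots.card = Fintype.card m := by
    rw [← hsplit.natDegree_eq_card_roots, charpoly_natDegree_eq_dim]
  have h₁ : (1 + s • K).det = (-s) ^ Fintype.card m * K.charpoly.eval (-s⁻¹) := by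
    rw [eval_charpoly, ← det_smul]
    congr 1
    rw [smul_sub, neg_smul s K, sub_neg_eq_add, scalar_apply, ← smul_one_eq_diagonal, smul_smul,
      neg_mul_neg, mul_inv_cancel₀ hs, one_smul]
  rw [h₁, hsplit.eval_eq_prod_roots_of_monic K.charpoly_monic, ← hcard,
    ← Multiset.prod_replicate, ← Multiset.map_const', ← Multiset.prod_map_mul]
  congr 1
  refine Multiset.map_congr rfl fun z _ => ?_
  field_simp
  ring

theorem norm_lt_one_of_mem_roots_charpoly {K : Matrix m m ℂ} (hK : ‖K‖ < 1) {z : ℂ}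
    (hz : z ∈ K.charpoly.roots) : ‖z‖ < 1 := by
  have h := mem_spectrum_of_isRoot_charpoly (Polynomial.isRoot_of_mem_roots hz)
  have : Nontrivial (Matrix m m ℂ) := by
    by_contra hcon
    rw [not_nontrivial_iff_subsingleton] at hcon
    rw [spectrum.of_subsingleton] at h
    exact h
  exact (spectrum.norm_le_norm_of_mem h).trans_lt hK

/-- One of `±‖Mᴴ M‖` is a spectral value of `Mᴴ M`. The plus sign makes `1 - ‖Mᴴ M‖` a spectral
value of the positive definite `Bᴴ B`; the minus sign forces the norm to be zero. -/
theorem norm_lt_one_of_conjTranspose_mul_self_add {M B : Matrix m m ℂ} (hB : IsUnit B)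
    (h : Mᴴ * M + Bᴴ * B = 1) : ‖M‖ < 1 := by
  rcases subsingleton_or_nontrivial (Matrix m m ℂ) with hs | hn
  · rw [Subsingleton.elim M 0, norm_zero]
    exact one_pos
  have hpos : (Bᴴ * B).PosDef :=
    (posSemidef_conjTranspose_mul_self B).posDef_iff_isUnit.mpr
      ((isUnit_conjTranspose B).mpr hB |>.mul hB)
  have hnorm : ‖Mᴴ * M‖ < 1 := by
    have hpsd := posSemidef_conjTranspose_mul_self M
    rcases CStarAlgebra.norm_or_neg_norm_mem_spectrum (a := Mᴴ * M) hpsd.1 with h₁ | h₁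
    · have h₂ : 1 - ‖Mᴴ * M‖ ∈ spectrum ℝ (Bᴴ * B) := by
        have h₃ : Bᴴ * B = algebraMap ℝ (Matrix m m ℂ) 1 - Mᴴ * M := by
          rw [map_one, ← h, add_sub_cancel_left]
        rw [h₃, ← spectrum.singleton_sub_eq]
        exact Set.sub_mem_sub rfl h₁
      linarith [(isStrictlyPositive_iff_posDef.mpr hpos).spectrum_pos h₂]
    · have h₂ := spectrum_nonneg_of_nonneg hpsd.nonneg h₁
      linarith
  rw [l2_opNorm_conjTranspose_mul_self] at hnorm
  nlinarith [norm_nonneg M]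

theorem isUnit_complexPart {A : Matrix (m ⊕ m) (m ⊕ m) ℝ} (hA : A ∈ symplecticGroup m ℝ) :
    IsUnit (complexPart A) := by
  have h := PosDef.one.add_posSemidef (posSemidef_self_mul_conjTranspose (antilinearPart A))
  have h₁ := h.isUnit
  rw [← complexPart_mul_conjTranspose hA, isUnit_iff_isUnit_det, det_mul] at h₁
  exact (isUnit_iff_isUnit_det _).mpr (isUnit_of_mul_isUnit_left h₁)

/-- The contraction `K` with `complexPart (A B) = complexPart A (1 + K) complexPart B`. -/
noncomputable def mulContraction (A B : Matrix (m ⊕ m) (m ⊕ m) ℝ) : Matrix m m ℂ :=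
  (complexPart A)⁻¹ * antilinearPart A * ((antilinearPart B).map conj * (complexPart B)⁻¹)

/-- Both factors `a⁻¹ b` and `b̄ a⁻¹` are strict contractions: multiply `a aᴴ = 1 + b bᴴ`,
respectively `aᴴ a = 1 + bᵀ b̄`, by `a⁻¹` and its adjoint on the two sides. -/
theorem norm_mulContraction_lt_one {A B : Matrix (m ⊕ m) (m ⊕ m) ℝ}
    (hA : A ∈ symplecticGroup m ℝ) (hB : B ∈ symplecticGroup m ℝ) :
    ‖mulContraction A B‖ < 1 := by
  have hA' := isUnit_complexPart hA
  have hB' := isUnit_complexPart hB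
  have hAd := (isUnit_iff_isUnit_det _).mp hA'
  have hBd := (isUnit_iff_isUnit_det _).mp hB'
  have h₁ : ‖(complexPart A)⁻¹ * antilinearPart A‖ < 1 := by
    rw [← l2_opNorm_conjTranspose]
    refine norm_lt_one_of_conjTranspose_mul_self_add (B := ((complexPart A)⁻¹)ᴴ)
      ((isUnit_conjTranspose _).mpr ((isUnit_nonsing_inv_iff).mpr hA')) ?_
    have h := complexPart_mul_conjTranspose hA
    simp only [conjTranspose_mul, conjTranspose_conjTranspose]
    calc _ = (complexPart A)⁻¹ * (1 + antilinearPart A * (antilinearPart A)ᴴ) *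
          ((complexPart A)⁻¹)ᴴ := by
            simp only [mul_add, add_mul, mul_one, mul_assoc]
            rw [add_comm]
      _ = 1 := by
            rw [← h, ← mul_assoc, nonsing_inv_mul _ hAd, one_mul, ← conjTranspose_mul,
              nonsing_inv_mul _ hAd, conjTranspose_one]
  have h₂ : ‖(antilinearPart B).map conj * (complexPart B)⁻¹‖ < 1 := by
    refine norm_lt_one_of_conjTranspose_mul_self_add (B := (complexPart B)⁻¹)
      ((isUnit_nonsing_inv_iff).mpr hB') ?_
    have h := conjTranspose_mul_complexPart hB
    simp only [conjTranspose_mul]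
    calc _ = ((complexPart B)⁻¹)ᴴ * (1 + ((antilinearPart B).map conj)ᴴ *
          (antilinearPart B).map conj) * (complexPart B)⁻¹ := by
            simp only [mul_add, add_mul, mul_one, mul_assoc]
            rw [add_comm]
      _ = 1 := by
            rw [← h, mul_assoc, mul_assoc, mul_nonsing_inv _ hBd, mul_one, ← conjTranspose_mul,
              mul_nonsing_inv _ hBd, conjTranspose_one]
  exact (norm_mul_le _ _).trans_lt (mul_lt_one_of_nonneg_of_lt_one_left (norm_nonneg _) h₁ h₂.le)

theorem det_complexPart_mul {A B : Matrix (m ⊕ m) (m ⊕ m) ℝ}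
    (hA : A ∈ symplecticGroup m ℝ) (hB : B ∈ symplecticGroup m ℝ) :
    (complexPart (A * B)).det =
      (complexPart A).det * (complexPart B).det * (1 + mulContraction A B).det := by
  have hAd := (isUnit_iff_isUnit_det _).mp (isUnit_complexPart hA)
  have hBd := (isUnit_iff_isUnit_det _).mp (isUnit_complexPart hB)
  have h : complexPart (A * B) = complexPart A * (1 + mulContraction A B) * complexPart B := by
    rw [complexPart_mul, mulContraction, mul_add, add_mul, mul_one]
    congr 1
    rw [mul_assoc (complexPart A)⁻¹, ← mul_assoc (complexPart A), mul_nonsing_inv _ hAd, one_mul,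
      mul_assoc, mul_assoc, nonsing_inv_mul _ hBd, mul_one]
  rw [h, det_mul, det_mul]
  ring

end Det

/-! ### Continuous logarithms of nonvanishing functions. -/

section Lift

open unitInterval

theorem exists_log_of_simplyConnected {X : Type*} [TopologicalSpace X] [SimplyConnectedSpace X]
    [LocallyPathConnectedSpace X] {f : X → ℂ} (hf : Continuous f) (hf₀ : ∀ x, f x ≠ 0) {x₀ : X}
    (h : f x₀ = 1) :
    ∃ F : X → ℂ, Continuous F ∧ F x₀ = 0 ∧ ∀ x, Complex.exp (F x) = f x := by
  obtain ⟨F, ⟨hF₀, hF⟩, -⟩ := Complex.isCoveringMapOn_exp.existsUnique_continuousMap_lifts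
    ⟨f, hf⟩ (a₀ := x₀) (e₀ := 0) (by simp [h]) hf₀
  exact ⟨F, F.continuous, hF₀, congrFun hF⟩

/-- A nonvanishing function on the interval that starts at `1` has a continuous logarithm. -/
theorem exists_log_interval {f : I → ℂ} (hf : Continuous f) (hf₀ : ∀ x, f x ≠ 0) (h : f 0 = 1) :
    ∃ F : I → ℂ, Continuous F ∧ F 0 = 0 ∧ ∀ x, Complex.exp (F x) = f x := by
  -- Extending `f` by its end values moves the lifting problem to the simply connected space `ℝ`.
  obtain ⟨F, hF, hF₀, hF'⟩ := exists_log_of_simplyConnected (X := ℝ) (x₀ := 0)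
    (f := fun x => f (Set.projIcc 0 1 zero_le_one x)) (hf.comp continuous_projIcc)
    (fun x => hf₀ _) (by simpa using h)
  exact ⟨fun x => F x, by fun_prop, hF₀, fun x => by simp [hF']⟩

/-- A nonvanishing function on the square with value `1` at the origin has a continuous
logarithm. -/
theorem exists_log_square {f : I → I → ℂ} (hf : Continuous fun p : I × I => f p.1 p.2)
    (hf₀ : ∀ s t, f s t ≠ 0) (h : f 0 0 = 1) :
    ∃ F : I → I → ℂ, (Continuous fun p : I × I => F p.1 p.2) ∧ F 0 0 = 0 ∧
      ∀ s t, Complex.exp (F s t) = f s t := by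
  have hproj : Continuous fun x : ℝ => Set.projIcc (0 : ℝ) 1 zero_le_one x := continuous_projIcc
  obtain ⟨F, hF, hF₀, hF'⟩ := exists_log_of_simplyConnected (X := ℝ × ℝ) (x₀ := (0, 0))
    (f := fun x => f (Set.projIcc 0 1 zero_le_one x.1) (Set.projIcc 0 1 zero_le_one x.2))
    (hf.comp ((hproj.comp continuous_fst).prodMk (hproj.comp continuous_snd))) (fun x => hf₀ _ _) (by simpa using h)
  exact ⟨fun s t => F (s, t), by fun_prop, hF₀, fun s t => by simp [hF']⟩

/-- Continuous logarithms are determined by their value at one point. -/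
theorem eq_of_exp_eq {F F' : I → ℂ} (hF : Continuous F) (hF' : Continuous F')
    (h : ∀ t, Complex.exp (F t) = Complex.exp (F' t)) (h₀ : F 0 = F' 0) (t : I) : F t = F' t := by
  refine congrFun (Complex.isCoveringMap_exp.eq_of_comp_eq hF hF' ?_ 0 h₀) t
  ext t
  exact h t

end Lift

/-! ### The winding of the determinant, its defect, and its values over the unitary group. -/

section Rotation

open Matrix unitInterval

theorem det_complexPart_ne_zero {n : ℕ} (A : Sp n) : (complexPart A.1).det ≠ 0 :=
  ((isUnit_iff_isUnit_det _).mp (isUnit_complexPart A.2)).ne_zero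

theorem exists_log_det {n : ℕ} {γ : C(I, Sp n)} (hγ : γ 0 = 1) :
    ∃ F : I → ℂ, Continuous F ∧ F 0 = 0 ∧ ∀ t, Complex.exp (F t) = (complexPart (γ t).1).det := by
  refine exists_log_interval (by fun_prop) (fun t => det_complexPart_ne_zero _) ?_
  rw [hγ]
  exact (congrArg det complexPart_one).trans det_one

/-- The net change of the argument of the determinant of the complex linear part, in units of
full turns, as a function on the universal cover. -/
theorem exists_rotation (n : ℕ) : ∃ ρ : UniversalCover (Sp n) → ℝ,
    ∀ (γ : C(I, Sp n)) (hγ : γ 0 = 1) (F : I → ℂ), Continuous F → F 0 = 0 →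
      (∀ t, Complex.exp (F t) = (complexPart (γ t).1).det) →
        ρ (UniversalCover.mk γ hγ) = (F 1).im / (2 * Real.pi) := by
  have key : ∀ g : UniversalCover (Sp n), ∃ r : ℝ,
      ∀ (γ : C(I, Sp n)) (hγ : γ 0 = 1) (F : I → ℂ), g = UniversalCover.mk γ hγ →
        Continuous F → F 0 = 0 → (∀ t, Complex.exp (F t) = (complexPart (γ t).1).det) →
          r = (F 1).im / (2 * Real.pi) := by
    intro g
    obtain ⟨γ, hγ, rfl⟩ := UniversalCover.exists_eq_mk g
    obtain ⟨F, hF, hF₀, hFγ⟩ := exists_log_det hγ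
    refine ⟨(F 1).im / (2 * Real.pi), fun δ hδ F' hγδ hF' hF'₀ hFδ => ?_⟩
    congr 2
    obtain ⟨H⟩ := UniversalCover.mk_eq_mk_iff.mp hγδ
    -- A logarithm over the whole homotopy: the determinant is constant on the edges `t = 0` and `t
    -- = 1`, so `L` is too, and both paths end at the same value.
    obtain ⟨L, hL, hL₀, hLH⟩ := exists_log_square (f := fun s t => (complexPart (H (s, t)).1).det)
      (continuous_complexPart.comp (continuous_subtype_val.comp H.continuous)).matrix_det
      (fun s t => det_complexPart_ne_zero _) (by
        rw [H.apply_zero, hγ]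
        exact (congrArg det complexPart_one).trans det_one)
    have hleft : ∀ s, L s 0 = 0 := fun s => by
      refine eq_of_exp_eq (F := fun s => L s 0) (F' := fun _ => 0) (by fun_prop) continuous_const
        (fun s => ?_) hL₀ s
      rw [hLH, H.eq_fst s (by simp), hγ, Complex.exp_zero]
      exact (congrArg det complexPart_one).trans det_one
    have hright : L 1 1 = L 0 1 := by
      refine eq_of_exp_eq (F := fun s => L s 1) (F' := fun _ => L 0 1) (by fun_prop)
        continuous_const (fun s => ?_) rfl 1
      rw [hLH, hLH, H.eq_fst s (by simp), H.eq_fst 0 (by simp)]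
    have h₀ : L 0 1 = F 1 := by
      refine eq_of_exp_eq (F := fun t => L 0 t) (by fun_prop) hF (fun t => ?_)
        (hL₀.trans hF₀.symm) 1
      rw [hLH, H.apply_zero, hFγ]
    have h₁ : L 1 1 = F' 1 := by
      refine eq_of_exp_eq (F := fun t => L 1 t) (by fun_prop) hF' (fun t => ?_)
        ((hleft 1).trans hF'₀.symm) 1
      rw [hLH, H.apply_one, hFδ]
    rw [← h₀, ← hright, h₁]
  choose ρ hρ using key
  exact ⟨ρ, fun γ hγ F => hρ _ γ hγ F rfl⟩

theorem det_one_add_smul_mulContraction_ne_zero {n : ℕ} (A B : Sp n) (s : I) :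
    (1 + ((s : ℝ) : ℂ) • mulContraction A.1 B.1).det ≠ 0 := by
  rw [det_one_add_smul_eq_prod, ne_eq, Multiset.prod_eq_zero_iff]
  intro h
  obtain ⟨z, hz, hz'⟩ := Multiset.mem_map.mp h
  have h₁ := norm_lt_one_of_mem_roots_charpoly (norm_mulContraction_lt_one A.2 B.2) hz
  have h₂ : ‖((s : ℝ) : ℂ) * z‖ < 1 := by
    rw [norm_mul, Complex.norm_real, Real.norm_of_nonneg s.2.1]
    exact mul_lt_one_of_nonneg_of_lt_one_right s.2.2 (norm_nonneg _) h₁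
  rw [← neg_eq_iff_add_eq_zero.mpr hz', norm_neg, norm_one] at h₂
  exact lt_irrefl _ h₂

theorem continuous_mulContraction {n : ℕ} (γ δ : C(I, Sp n)) :
    Continuous fun t => mulContraction (γ t).1 (δ t).1 := by
  have h : ∀ γ : C(I, Sp n), Continuous fun t => (complexPart (γ t).1)⁻¹ := by
    intro γ
    simp only [inv_def, Ring.inverse_eq_inv']
    refine Continuous.smul (Continuous.inv₀ (by fun_prop) fun t => det_complexPart_ne_zero _) ?_
    fun_prop
  have h₁ : Continuous fun t => (antilinearPart (δ t).1).map (starRingEnd ℂ) :=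
    Continuous.matrix_map (by fun_prop) Complex.continuous_conj
  exact ((h γ).mul (by fun_prop)).mul (h₁.mul (h δ))

theorem exists_log_mulContraction {n : ℕ} {ρ : UniversalCover (Sp n) → ℝ}
    (hρ : ∀ (γ : C(I, Sp n)) (hγ : γ 0 = 1) (F : I → ℂ), Continuous F → F 0 = 0 →
      (∀ t, Complex.exp (F t) = (complexPart (γ t).1).det) →
        ρ (UniversalCover.mk γ hγ) = (F 1).im / (2 * Real.pi))
    (g h : UniversalCover (Sp n)) :
    ∃ L : I → ℂ, Continuous L ∧ L 0 = 0 ∧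
      (∀ s, Complex.exp (L s) = (1 + ((s : ℝ) : ℂ) • mulContraction
        (UniversalCover.endpoint (Sp n) g).1 (UniversalCover.endpoint (Sp n) h).1).det) ∧
      ρ (g * h) - ρ g - ρ h = (L 1).im / (2 * Real.pi) := by
  obtain ⟨γ, hγ, rfl⟩ := UniversalCover.exists_eq_mk g
  obtain ⟨δ, hδ, rfl⟩ := UniversalCover.exists_eq_mk h
  obtain ⟨F, hF, hF₀, hFγ⟩ := exists_log_det hγ
  obtain ⟨F', hF', hF'₀, hFδ⟩ := exists_log_det hδ
  have hK := continuous_mulContraction γ δ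
  have hK₀ : mulContraction (γ 0).1 (δ 0).1 = 0 := by
    rw [hγ, mulContraction]
    change _ * antilinearPart (1 : Matrix _ _ ℝ) * _ = 0
    rw [antilinearPart_one, mul_zero, zero_mul]
  have hre : Continuous fun p : I × I => ((p.1 : ℝ) : ℂ) := by fun_prop
  have hKs : Continuous fun p : I × I =>
      ((p.1 : ℝ) : ℂ) • mulContraction (γ p.2).1 (δ p.2).1 :=
    hre.smul (hK.comp continuous_snd)
  -- `L` vanishes on the edges `s = 0` and `t = 0`. The edge `s = 1` computes the defect along the
  -- paths and `t = 1` involves only their endpoints; they meet at `L 1 1`.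
  obtain ⟨L, hL, hL₀, hLK⟩ := exists_log_square
    (f := fun s t => (1 + ((s : ℝ) : ℂ) • mulContraction (γ t).1 (δ t).1).det)
    (continuous_const.add hKs).matrix_det (fun s t => det_one_add_smul_mulContraction_ne_zero _ _ _) (by simp)
  have hleft : ∀ s, L s 0 = 0 := fun s => by
    refine eq_of_exp_eq (F := fun s => L s 0) (F' := fun _ => 0) (by fun_prop) continuous_const
      (fun s => ?_) hL₀ s
    rw [hLK, hK₀, smul_zero, add_zero, det_one, Complex.exp_zero]
  have hbot : ∀ t, L 0 t = 0 := fun t => by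
    refine eq_of_exp_eq (F := fun t => L 0 t) (F' := fun _ => 0) (by fun_prop) continuous_const
      (fun t => ?_) hL₀ t
    simp [hLK]
  refine ⟨fun s => L s 1, by fun_prop, hbot 1, fun s => hLK s 1, ?_⟩
  rw [hρ γ hγ F hF hF₀ hFγ, hρ δ hδ F' hF' hF'₀ hFδ, UniversalCover.mk_mul_mk,
    hρ _ _ (fun t => F t + F' t + L 1 t) (by fun_prop) (by simp [hF₀, hF'₀, hleft]) fun t => ?_]
  · rw [Complex.add_im, Complex.add_im]
    ring
  · rw [Complex.exp_add, Complex.exp_add, hFγ, hFδ, hLK]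
    refine Eq.trans ?_ (det_complexPart_mul (γ t).2 (δ t).2).symm
    simp

theorem abs_im_log_mulContraction_le {n : ℕ} (A B : Sp n) {L : I → ℂ} (hL : Continuous L)
    (hL₀ : L 0 = 0)
    (hLK : ∀ s, Complex.exp (L s) = (1 + ((s : ℝ) : ℂ) • mulContraction A.1 B.1).det) :
    |(L 1).im| ≤ n * Real.pi := by
  set R := (mulContraction A.1 B.1).charpoly.roots with hR
  have hslit : ∀ z ∈ R, ∀ s : I, 1 + ((s : ℝ) : ℂ) * z ∈ Complex.slitPlane := by
    intro z hz s
    refine Complex.mem_slitPlane_of_norm_lt_one ?_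
    rw [norm_mul, Complex.norm_real, Real.norm_of_nonneg s.2.1]
    exact mul_lt_one_of_nonneg_of_lt_one_right s.2.2 (norm_nonneg _)
      (norm_lt_one_of_mem_roots_charpoly (norm_mulContraction_lt_one A.2 B.2) hz)
  -- Each factor `1 + s z` stays in the slit plane, so the sum of principal logarithms over the
  -- eigenvalues is a second continuous logarithm, also starting at `0`.
  have hsum : L 1 = (R.map fun z => Complex.log (1 + ((1 : I) : ℝ) * z)).sum := by
    refine eq_of_exp_eq (F' := fun s => (R.map fun z => Complex.log (1 + ((s : ℝ) : ℂ) * z)).sum)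
      hL ?_ (fun s => ?_) ?_ 1
    · refine continuous_multiset_sum _ fun z hz => ?_
      exact Continuous.clog (by fun_prop) (hslit z hz)
    · rw [hLK, det_one_add_smul_eq_prod, Complex.exp_multiset_sum, Multiset.map_map]
      congr 1
      refine Multiset.map_congr rfl fun z hz => ?_
      exact (Complex.exp_log (Complex.slitPlane_ne_zero (hslit z hz s))).symm
    · simp [hL₀]
  have hcard : R.card = n := by
    rw [hR, ← (IsAlgClosed.splits _).natDegree_eq_card_roots, charpoly_natDegree_eq_dim,
      Fintype.card_fin]
  rw [hsum, ← hcard]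
  generalize R = S
  induction S using Multiset.induction_on with
  | empty => simp
  | cons z S ih =>
    rw [Multiset.map_cons, Multiset.sum_cons, Complex.add_im, Multiset.card_cons, Nat.cast_succ]
    have h₁ : |(Complex.log (1 + ((1 : I) : ℝ) * z)).im| ≤ Real.pi := by
      rw [Complex.log_im]
      exact Complex.abs_arg_le_pi _
    linarith [abs_add_le (Complex.log (1 + ((1 : I) : ℝ) * z)).im
      (S.map fun z => Complex.log (1 + ((1 : I) : ℝ) * z)).sum.im]

/-- There is a homogeneous quasimorphism that descends to the determinant. -/
theorem exists_homogeneousQuasimorphism_descendsToDet (n : ℕ) :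
    ∃ μ : UniversalCover (Sp n) → ℝ, IsHomogeneousQuasimorphism μ ∧ DescendsToDet μ := by
  obtain ⟨ρ, hρ⟩ := exists_rotation n
  have hquasi : IsQuasimorphism ρ := by
    refine ⟨n * Real.pi / (2 * Real.pi), fun g h => ?_⟩
    obtain ⟨L, hL, hL₀, hLK, heq⟩ := exists_log_mulContraction hρ g h
    rw [heq, abs_div, abs_of_pos Real.two_pi_pos]
    exact div_le_div_of_nonneg_right (abs_im_log_mulContraction_le _ _ hL hL₀ hLK)
      Real.two_pi_pos.le
  -- A complex linear right factor has `K = 0`, so there is no defect.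
  have hadd : ∀ g h : UniversalCover (Sp n),
      antilinearPart (UniversalCover.endpoint (Sp n) h).1 = 0 → ρ (g * h) = ρ g + ρ h := by
    intro g h hh
    obtain ⟨L, hL, hL₀, hLK, heq⟩ := exists_log_mulContraction hρ g h
    have h₁ : L 1 = 0 := by
      refine eq_of_exp_eq (F' := fun _ => 0) hL continuous_const (fun s => ?_) hL₀ 1
      simp [hLK, mulContraction, hh]
    rw [h₁, Complex.zero_im, zero_div] at heq
    linarith
  obtain ⟨μ, hμ, hμρ⟩ := hquasi.exists_homogenization
  refine ⟨μ, hμ, fun g X Y horth hXY => ?_⟩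
  have hanti := antilinearPart_eq_zero (UniversalCover.endpoint (Sp n) g).2 horth
  have hg : μ g = ρ g := by
    refine hμρ g fun k => ?_
    induction k with
    | zero =>
      have h := hadd 1 1 (by rw [map_one]; exact antilinearPart_one)
      rw [mul_one] at h
      simp only [pow_zero, Nat.cast_zero, zero_mul]
      linarith
    | succ k ih =>
      rw [pow_succ, hadd _ _ hanti, ih]
      push_cast
      ring
  have hunit := complexPart_mem_unitary (UniversalCover.endpoint (Sp n) g).2 horth
  have hcp : complexPart (UniversalCover.endpoint (Sp n) g).1 =
      X.map Complex.ofReal + Complex.I • Y.map Complex.ofReal := by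
    rw [hXY]
    ext i j
    apply Complex.ext <;> simp [complexPart]
  obtain ⟨γ, hγ, rfl⟩ := UniversalCover.exists_eq_mk g
  obtain ⟨F, hF, hF₀, hFγ⟩ := exists_log_det hγ
  rw [← hcp, hg, hρ γ hγ F hF hF₀ hFγ, UniversalCover.endpoint_mk, ← hFγ]
  -- The determinant of a unitary matrix has modulus one, so `F 1` is purely imaginary and is
  -- recovered from its imaginary part.
  have hnorm : ‖Complex.exp (F 1)‖ = 1 := by
    rw [hFγ]
    exact CStarRing.norm_of_mem_unitary (det_of_mem_unitary hunit)
  rw [Complex.norm_exp, Real.exp_eq_one_iff] at hnorm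
  congr 1
  have hpi : (Real.pi : ℂ) ≠ 0 := by exact_mod_cast Real.pi_ne_zero
  rw [← Complex.re_add_im (F 1), hnorm]
  simp only [Complex.ofReal_zero, zero_add, Complex.ofReal_div, Complex.ofReal_mul,
    Complex.ofReal_ofNat, Complex.mul_im, Complex.ofReal_im, Complex.ofReal_re, Complex.I_re,
    Complex.I_im, mul_one, mul_zero, add_zero]
  field_simp

/-- The difference of two homogeneous quasimorphisms that descend to the determinant has integral
values over the unitary group. -/
theorem DescendsToDet.exists_int_sub {n : ℕ} {μ ν : UniversalCover (Sp n) → ℝ}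
    (hμ : DescendsToDet μ) (hν : DescendsToDet ν) (g : UniversalCover (Sp n))
    (U : unitary (Matrix (Fin n) (Fin n) ℂ))
    (hg : UniversalCover.endpoint (Sp n) g = unitaryToSp n U) : ∃ k : ℤ, μ g - ν g = k := by
  have horth : (UniversalCover.endpoint (Sp n) g).1 ∈ orthogonalGroup (Fin n ⊕ Fin n) ℝ := by
    rw [hg]
    exact realify_mem_orthogonalGroup U.2
  have h := (hμ g _ _ horth (congrArg Subtype.val hg)).symm.trans
    (hν g _ _ horth (congrArg Subtype.val hg))
  obtain ⟨k, hk⟩ := Complex.exp_eq_exp_iff_exists_int.mp h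
  refine ⟨k, ?_⟩
  have h₁ : (2 * Real.pi * Complex.I : ℂ) * (μ g - ν g - k) = 0 := by
    linear_combination hk
  have h₂ := (mul_eq_zero.mp h₁).resolve_left Complex.two_pi_I_ne_zero
  exact sub_eq_zero.mp (by exact_mod_cast h₂)

end Rotation

theorem theorem1 (n : ℕ) :
    ∃! μ : UniversalCover (Sp n) → ℝ, IsHomogeneousQuasimorphism μ ∧ DescendsToDet μ := by
  obtain ⟨μ, hμ, hμ'⟩ := exists_homogeneousQuasimorphism_descendsToDet n
  refine ⟨μ, ⟨hμ, hμ'⟩, fun ν ⟨hν, hν'⟩ => ?_⟩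
  ext g
  exact sub_eq_zero.mp ((hν.sub hμ).eq_zero_of_integral (hν'.exists_int_sub hμ') g)
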